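/- Let $R$ be an integral domain, let $w\in R$ (for instance $R=\mathbb{Z}[w]$ with $w$ an indeterminate), and let $X_1,\dots,X_n$ be indeterminates. For a polynomial $f$ in $X_1,\dots,X_n$ over $R$ put $$\mathbf{ASym}_{X_1,\dots,X_n} f(X_1,\dots,X_n)=\sum_{\sigma\in\mathcal S_n}\operatorname{sgn}\sigma\cdot f(X_{\sigma(1)},\dots,X_{\sigma(n)}).$$ Then, for all integers $n\ge 1$ and $m\ge 0$, the following identity holds in the field of rational functions in $X_1,\dots,X_n$ over the fraction field of $R$: $$\frac{1}{\prod_{1\le i<j\le n}(X_j-X_i)}\,\mathbf{ASym}_{X_1,\dots,X_n}\left[\prod_{1\le i<j\le n}(1+wX_i+X_j+X_iX_j)\sum_{0\le k_1<k_2<\dots<k_n\le m}X_1^{k_1}X_2^{k_2}\cdots X_n^{k_n}\right]$$ $$=\frac{\det_{1\le i,j\le n}\left(X_i^{j-1}(1+X_i)^{j-1}(1+wX_i)^{n-j}-X_i^{m+2n-j}(1+X_i^{-1})^{j-1}(1+wX_i^{-1})^{n-j}\right)}{\prod_{i=1}^n(1-X_i)\,\prod_{1\le i<j\le n}(1-X_iX_j)(X_j-X_i)}.$$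 -/

import Mathlib

/-- The antisymmetrizer: `ASym f = ∑ σ, sgn σ · f(X_{σ(1)}, …, X_{σ(n)})`, for a polynomial `f`
in the variables `X_1, …, X_n` (the summand is `f` with every `X_i` replaced by `X_{σ(i)}`). -/
noncomputable def ASym {n : ℕ} {R : Type*} [CommRing R] (f : MvPolynomial (Fin n) R) :
    MvPolynomial (Fin n) R :=
  ∑ σ : Equiv.Perm (Fin n),
    ((Equiv.Perm.sign σ : ℤ) : MvPolynomial (Fin n) R) * MvPolynomial.rename σ f

/-- The field of rational functions in `X_1, …, X_n` with coefficients in the fraction field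
of the integral domain `R`. -/
abbrev RatFunField (n : ℕ) (R : Type*) [CommRing R] : Type _ :=
  FractionRing (MvPolynomial (Fin n) R)

/-- A polynomial, regarded as a rational function. -/
noncomputable abbrev toRat {n : ℕ} {R : Type*} [CommRing R] (f : MvPolynomial (Fin n) R) :
    RatFunField n R :=
  algebraMap (MvPolynomial (Fin n) R) (RatFunField n R) f

/-- The variable `X_i`, as a rational function. The index `i : Fin n` starts at `0`. -/
noncomputable abbrev ratX {n : ℕ} (R : Type*) [CommRing R] (i : Fin n) : RatFunField n R :=
  toRat (MvPolynomial.X i)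

/-- The coefficient `c`, as a constant rational function. -/
noncomputable abbrev ratC (n : ℕ) {R : Type*} [CommRing R] (c : R) : RatFunField n R :=
  toRat (MvPolynomial.C c)

/-!
Put `M = m + 1`. After multiplication by the denominators, both sides of the identity are functions
of `n`, `M` and a point `x` of a field, and both satisfy the same recursion that expresses the
value at `(n + 1, M + 1)` through the one at `(n + 1, M)` and the ones at `(n, M)` for the points
obtained by deleting one coordinate. The identity follows by induction on `M`
(`littlewoodSum_mul_eq_reflectedDet`).

On the side of the antisymmetrizer (`littlewoodSum_succ`), the recursion arises from splitting the
sum over `k_1 < ⋯ < k_n` according to whether `k_1 = 0` or not.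

On the side of the determinant, the entries are `A ^ j B ^ (n-1-j) - x ^ M C ^ j D ^ (n-1-j)` with
`A = x (1 + x)`, `B = 1 + w x`, `C = 1 + x`, `D = x (x + w)`. Since `A + B = C + D =: s` and
`A = x C`, unitriangular column operations (`det_monomial_sub_eq_det_pow_sub`) turn the determinant,
up to the factor `∏ s_i ^ (n-1)`, into that of `t_i ^ j - x_i ^ M y_i ^ j`, where `y = C / s` and
`t = x y` (`reflectedDet_eq`). For `M = 0` its first column vanishes. The coefficients of the
recursion become products of the differences `y_j - t_i`, because
`s_i s_j (y_j - t_i) = (1 - x_i x_j) (1 + w x_i + x_j + x_i x_j)`, and the recursion is then an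
identity between determinants in which the `x_i`, the `y_i` and the powers `x_i ^ M` may be
arbitrary (`det_sub_smul_recursion`).
-/

/-! ### Determinants with entries `t ^ j - c y ^ j` -/

theorem exists_prod_sub_eq_prod_add_mul_sum {K : Type*} [Field K] {n : ℕ} (y : Fin (n + 1) → K) :
    ∃ q : Fin (n + 1) → K, q (Fin.last n) = (-1) ^ (n + 1) ∧
      ∀ u, ∏ j, (y j - u) = ∏ j, y j + u * ∑ l, q l * u ^ (l : ℕ) := by
  let P : Polynomial K := ∏ j, (Polynomial.C (y j) - Polynomial.X)
  have hdeg : P.natDegree ≤ n + 1 := by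
    refine (Polynomial.natDegree_prod_le _ _).trans ?_
    refine (Finset.sum_le_sum (g := fun _ => 1) fun j _ => ?_).trans (by simp)
    exact (Polynomial.natDegree_sub_le _ _).trans (by simp)
  have hev : ∀ u, P.eval u = ∏ j, (y j - u) := fun u => by
    simp [P, Polynomial.eval_prod]
  have hc0 : P.coeff 0 = ∏ j, y j := by
    rw [Polynomial.coeff_zero_eq_eval_zero, hev]; simp
  refine ⟨fun l => P.coeff (l + 1), ?_, fun u => ?_⟩
  · have h := Polynomial.coeff_prod_of_natDegree_le (Finset.univ : Finset (Fin (n + 1)))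
      (fun j => Polynomial.C (y j) - Polynomial.X) 1
      (fun j _ => (Polynomial.natDegree_sub_le _ _).trans (by simp))
    simpa [P, Polynomial.coeff_X_one, Polynomial.coeff_C] using h
  · rw [← hev, Polynomial.eval_eq_sum_range' (n := n + 2) (by omega), Finset.sum_range_succ',
      ← hc0, add_comm, Finset.mul_sum, ← Fin.sum_univ_eq_sum_range
        (fun l => P.coeff (l + 1) * u ^ (l + 1))]
    simp only [pow_zero, mul_one, pow_succ]
    congr 1
    exact Finset.sum_congr rfl fun l _ => by ring

open Matrix in
/-- Write `t_i = x_i y_i`. The sum over `i` is the Laplace expansion, along its first column, of a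
determinant with columns `c, v_0, …, v_{n-1}`, where `v_l = (t_i ^ l - Y_i y_i ^ l)_i`. With
`P(u) = ∏ (y_j - u)`, the entries of `c` are `∏ x_j` times `P(t_i) / t_i`, and since `P(y_i) = 0`,
the column `c` is a linear combination of `v_{-1}, v_0, …, v_n`. Only the terms with `v_{-1}` and
`v_n` survive, and they give the two determinants of size `n + 1`. -/
theorem det_sub_smul_recursion {K : Type*} [Field K] {n : ℕ} (x y Y : Fin (n + 1) → K)
    (hx : ∀ i, x i ≠ 0) (hy : ∀ i, y i ≠ 0) :
    det (of fun i j : Fin (n + 1) => (x i * y i) ^ (j : ℕ) - x i * Y i * y i ^ (j : ℕ)) =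
      (∏ i, x i) * det (of fun i j : Fin (n + 1) => (x i * y i) ^ (j : ℕ) - Y i * y i ^ (j : ℕ)) +
      ∑ i : Fin (n + 1), (-1) ^ (i : ℕ) * ((1 - x i) *
          ∏ j, (x (i.succAbove j) * (y (i.succAbove j) - x i * y i))) *
        det (of fun k j : Fin n => (x (i.succAbove k) * y (i.succAbove k)) ^ (j : ℕ)
          - Y (i.succAbove k) * y (i.succAbove k) ^ (j : ℕ)) := by
  obtain ⟨q, hq, hP⟩ := exists_prod_sub_eq_prod_add_mul_sum y
  -- `v l` is the column with entries `t_i ^ l - Y_i y_i ^ l`, where `t_i = x_i y_i`.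
  let v : ℕ → Fin (n + 1) → K := fun l i => (x i * y i) ^ l - Y i * y i ^ l
  let W : Matrix (Fin (n + 1)) (Fin (n + 1)) K := of fun i j => v j i
  -- `M` has the columns `v n, v 0, …, v (n - 1)`.
  let σ : Equiv.Perm (Fin (n + 1)) := (Fin.cycleRange (Fin.last n)).symm
  let M : Matrix (Fin (n + 1)) (Fin (n + 1)) K := W.submatrix id σ
  have hMs : ∀ i (j : Fin n), M i j.succ = v j i := fun i j => by
    change v (σ j.succ) i = v j i
    rw [Fin.cycleRange_symm_succ, Fin.succAbove_last, Fin.val_castSucc]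
  have hMdet : M.det = (-1) ^ n * W.det := by
    rw [det_permute']; simp [σ]
  -- the column `t_i⁻¹ - Y_i y_i⁻¹`, which extends the sequence `v` to the index `-1`
  let b : Fin (n + 1) → K := fun i => (x i * y i)⁻¹ - Y i * (y i)⁻¹
  let c : Fin (n + 1) → K := fun i => (1 - x i) *
          ∏ j, (x (i.succAbove j) * (y (i.succAbove j) - x i * y i))
  have hsum : ∀ i, ∑ k, q (σ k) * M i k = ∑ l, q l * v l i := fun i =>
    Equiv.sum_comp σ (fun l => q l * v l i)
  -- `P(t_i) / t_i = P(0) / t_i + Q(t_i)` with `Q(y_i) = -P(0) / y_i`, where `P = P(0) + X Q`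
  have hc : c = (∏ j, x j) • ((∏ j, y j) • b + fun i => ∑ k, q (σ k) * M i k) := by
    funext i
    have hxi := hx i
    have hyi := hy i
    have h1 := hP (x i * y i)
    have h2 := hP (y i)
    rw [Finset.prod_eq_zero (Finset.mem_univ i) (sub_self _)] at h2
    have h3 : ∑ l, q l * v l i = ∑ l, q l * (x i * y i) ^ (l : ℕ)
        - Y i * ∑ l, q l * y i ^ (l : ℕ) := by
      rw [Finset.mul_sum, ← Finset.sum_sub_distrib]
      exact Finset.sum_congr rfl fun l _ => by simp only [v]; ring
    simp only [Pi.smul_apply, Pi.add_apply, smul_eq_mul, hsum, h3, c, b, Finset.prod_mul_distrib]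
    rw [Fin.prod_univ_succAbove _ i] at h1
    rw [Fin.prod_univ_succAbove x i]
    generalize ∏ j, y j = p at *
    generalize ∑ l, q l * (x i * y i) ^ (l : ℕ) = A at *
    generalize ∑ l, q l * y i ^ (l : ℕ) = B at *
    generalize ∏ j, (y (i.succAbove j) - x i * y i) = r at *
    generalize ∏ j, x (i.succAbove j) = X at *
    have hp : p = - (y i * B) := by linear_combination -h2
    subst hp
    have h4 : (1 - x i) * r = x i * A - B := by
      apply mul_left_cancel₀ hyi
      linear_combination h1
    field_simp
    linear_combination X * h4
  -- Laplace expansion along column `0`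
  have hexp : ∑ i : Fin (n + 1), (-1) ^ (i : ℕ) * c i *
        det (of fun k j : Fin n => (x (i.succAbove k) * y (i.succAbove k)) ^ (j : ℕ)
          - Y (i.succAbove k) * y (i.succAbove k) ^ (j : ℕ)) = det (M.updateCol 0 c) := by
    rw [det_succ_column_zero]
    refine Finset.sum_congr rfl fun i _ => ?_
    rw [updateCol_self]
    congr 2
    ext k j
    simp [hMs, v]
  -- Multiplying row `i` by `x i * y i` turns `b, v 0, …, v (n - 1)` into the columns of the
  -- left-hand side of the recursion.
  have hb : (∏ j, x j) * ((∏ j, y j) * det (M.updateCol 0 b)) =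
      det (of fun i j : Fin (n + 1) => (x i * y i) ^ (j : ℕ) - x i * Y i * y i ^ (j : ℕ)) := by
    rw [← mul_assoc, ← Finset.prod_mul_distrib, ← det_mul_column]
    congr 1
    ext i j
    have hxi := hx i
    have hyi := hy i
    refine Fin.cases ?_ (fun j => ?_) j
    · simp [b]; field_simp
    · simp [hMs, v, updateCol_apply]; ring
  -- Of the combination of the columns of `M`, only the multiple of column `0`, which is `v n`,
  -- contributes.
  have hrest : det (M.updateCol 0 fun i => ∑ k, q (σ k) * M i k) = - W.det := by
    rw [show (fun i => ∑ k, q (σ k) * M i k) = fun i => ∑ k, (fun k => q (σ k)) k • M i k from rfl,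
      det_updateCol_sum, hMdet]
    simp only [σ, Fin.cycleRange_symm_zero, hq, smul_eq_mul]
    rw [← mul_assoc, ← pow_add]
    rw [Odd.neg_one_pow ⟨n, by ring⟩]; ring
  change _ = (∏ i, x i) * W.det + ∑ i : Fin (n + 1), (-1) ^ (i : ℕ) * c i * _
  rw [hexp, hc, det_updateCol_smul, det_updateCol_add, det_updateCol_smul, hrest, ← hb]
  ring

/-- The polynomials `X ^ j (1 - X) ^ (n - 1 - j)` and `X ^ j`, for `j < n`, are related by a
unitriangular matrix, and the entries of both determinants are the values on them of the linear
functionals `p ↦ p(t_i) - Y_i p(y_i)`. -/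
theorem det_monomial_sub_eq_det_pow_sub {K : Type*} [Field K] {n : ℕ} (t y Y : Fin n → K) :
    Matrix.det (Matrix.of fun i j : Fin n =>
      t i ^ (j : ℕ) * (1 - t i) ^ (n - (j + 1 : ℕ)) -
        Y i * (y i ^ (j : ℕ) * (1 - y i) ^ (n - (j + 1 : ℕ)))) =
    Matrix.det (Matrix.of fun i j : Fin n => t i ^ (j : ℕ) - Y i * y i ^ (j : ℕ)) := by
  let p : Fin n → Polynomial K := fun j =>
    Polynomial.X ^ (j : ℕ) * (1 - Polynomial.X) ^ (n - (j + 1 : ℕ))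
  let T : Matrix (Fin n) (Fin n) K := Matrix.of fun l j => (p j).coeff l
  have hT : T.det = 1 := by
    rw [Matrix.det_of_isLowerTriangular]
    · refine Finset.prod_eq_one fun j _ => ?_
      simp only [T, p, Matrix.of_apply]
      rw [Polynomial.coeff_X_pow_mul', if_pos le_rfl, Nat.sub_self,
        Polynomial.coeff_zero_eq_eval_zero]
      simp
    · intro l j hlj
      have : l < j := by simpa using hlj
      simp only [T, p, Matrix.of_apply]
      rw [Polynomial.coeff_X_pow_mul', if_neg (by simpa using this)]
  have hev : ∀ u j, ∑ l : Fin n, u ^ (l : ℕ) * (p j).coeff l =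
      u ^ (j : ℕ) * (1 - u) ^ (n - (j + 1 : ℕ)) := fun u j => by
    have hdeg : (p j).natDegree < n := by
      have h1 : ((1 - Polynomial.X : Polynomial K) ^ (n - (j + 1 : ℕ))).natDegree ≤
          n - (j + 1 : ℕ) := by
        refine Polynomial.natDegree_pow_le.trans ?_
        have : (1 - Polynomial.X : Polynomial K).natDegree ≤ 1 :=
          (Polynomial.natDegree_sub_le _ _).trans (by simp)
        simpa using Nat.mul_le_mul_left (n - (j + 1 : ℕ)) this
      have h2 := Polynomial.natDegree_mul_le (p := (Polynomial.X : Polynomial K) ^ (j : ℕ))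
        (q := (1 - Polynomial.X) ^ (n - (j + 1 : ℕ)))
      rw [Polynomial.natDegree_X_pow] at h2
      have := j.2
      simp only [p]
      omega
    have h : (p j).eval u = u ^ (j : ℕ) * (1 - u) ^ (n - (j + 1 : ℕ)) := by simp [p]
    rw [← h, Polynomial.eval_eq_sum_range' hdeg,
      ← Fin.sum_univ_eq_sum_range (fun l => (p j).coeff l * u ^ l)]
    exact Finset.sum_congr rfl fun l _ => mul_comm _ _
  calc
    _ = Matrix.det (Matrix.of (fun i j : Fin n => t i ^ (j : ℕ) - Y i * y i ^ (j : ℕ)) * T) := by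
      congr 1
      ext i j
      simp only [Matrix.of_apply, Matrix.mul_apply, T, sub_mul, Finset.sum_sub_distrib, hev,
        mul_assoc, ← Finset.mul_sum]
    _ = _ := by rw [Matrix.det_mul, hT, mul_one]

/-! ### Antisymmetrized sums and products over pairs -/

/-- The sum of `x_1 ^ k_1 ⋯ x_n ^ k_n` over all `0 ≤ k_1 < ⋯ < k_n < M`. The upper bound `M` is
excluded, so that `M = 0` is the natural start of an induction. -/
def strictMonoSum {K : Type*} [CommRing K] (M : ℕ) {n : ℕ} (x : Fin n → K) : K :=
  ∑ k : Fin n → Fin M with (∀ i j : Fin n, i < j → k i < k j), ∏ i, x i ^ (k i : ℕ)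

/-- The first summand collects the `k` with `k_1 > 0`, the second one those with `k_1 = 0`. -/
theorem strictMonoSum_succ {K : Type*} [CommRing K] (M : ℕ) {n : ℕ} (x : Fin (n + 1) → K) :
    strictMonoSum (M + 1) x = (∏ i, x i) * strictMonoSum M x +
      (∏ i : Fin n, x i.succ) * strictMonoSum M (fun i => x i.succ) := by
  unfold strictMonoSum
  rw [← Finset.sum_filter_add_sum_filter_not _ (fun k => k 0 ≠ 0), Finset.mul_sum,
    Finset.mul_sum]
  congr 1
  · symm
    refine Finset.sum_nbij (fun k i => (k i).succ) ?_ ?_ ?_ ?_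
    · intro k hk
      simpa using hk
    · intro k _ k' _ h
      funext i
      simpa using congrFun h i
    · intro k hk
      simp only [Finset.coe_filter, Finset.mem_filter, Finset.mem_univ, true_and,
        Set.mem_ofPred_eq] at hk
      have h0 : ∀ i, k i ≠ 0 := fun i => by
        rcases Fin.eq_zero_or_eq_succ i with rfl | ⟨j, rfl⟩
        · exact hk.2
        · exact ((Fin.zero_le _).trans_lt (hk.1 0 j.succ (Fin.succ_pos j))).ne'
      refine ⟨fun i => (k i).pred (h0 i), ?_, ?_⟩
      · simpa using hk.1
      · funext i; simp
    · intro k _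
      simp [pow_succ', Finset.prod_mul_distrib]
  · symm
    refine Finset.sum_nbij (fun k => Fin.cons 0 fun i => (k i).succ) ?_ ?_ ?_ ?_
    · intro k hk
      simp only [Finset.mem_filter, Finset.mem_univ, true_and] at hk
      simp only [Finset.mem_filter, Finset.mem_univ, true_and, Fin.cons_zero, not_not, and_true]
      intro i j hij
      rcases Fin.eq_zero_or_eq_succ j with rfl | ⟨j, rfl⟩
      · exact absurd hij (Fin.not_lt_zero i)
      rcases Fin.eq_zero_or_eq_succ i with rfl | ⟨i, rfl⟩
      · simp
      · simpa using hk i j (by simpa using hij)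
    · intro k _ k' _ h
      funext i
      simpa using congrFun h i.succ
    · intro k hk
      simp only [Finset.coe_filter, Finset.mem_filter, Finset.mem_univ, true_and,
        Set.mem_ofPred_eq, not_not] at hk
      have h0 : ∀ i : Fin n, k i.succ ≠ 0 := fun i =>
        ((Fin.zero_le _).trans_lt (hk.1 0 i.succ (Fin.succ_pos i))).ne'
      refine ⟨fun i => (k i.succ).pred (h0 i), ?_, ?_⟩
      · simpa using fun i j hij => hk.1 (Fin.succ i) (Fin.succ j) (by simpa using hij)
      · funext i
        rcases Fin.eq_zero_or_eq_succ i with rfl | ⟨j, rfl⟩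
        · simp [hk.2]
        · simp
    · intro k _
      simp [Fin.prod_univ_succ, pow_succ', Finset.prod_mul_distrib]

/-- The signed sum over all permutations of the arguments of `f`. -/
def signedSum {K : Type*} [CommRing K] {n : ℕ} (f : (Fin n → K) → K) (x : Fin n → K) : K :=
  ∑ σ : Equiv.Perm (Fin n), ((Equiv.Perm.sign σ : ℤ) : K) * f (x ∘ σ)

/-- The permutations are grouped by the index `p` of the argument that comes first. -/
theorem signedSum_succ {K : Type*} [CommRing K] {n : ℕ} (f : (Fin (n + 1) → K) → K)
    (x : Fin (n + 1) → K) :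
    signedSum f x = ∑ p : Fin (n + 1),
      (-1) ^ (p : ℕ) * signedSum (fun z => f (Fin.cons (x p) z)) (fun i => x (p.succAbove i)) := by
  -- `e (p, τ)` sends `0` to `p` and acts on the remaining indices as `τ`; its sign is
  -- `(-1) ^ p` times the sign of `τ`.
  let e : Fin (n + 1) × Equiv.Perm (Fin n) → Equiv.Perm (Fin (n + 1)) := fun q =>
    q.1.cycleRange.symm * Equiv.Perm.decomposeFin.symm (0, q.2)
  have he0 : ∀ q, e q 0 = q.1 := fun q => by simp [e]
  have hes : ∀ q (i : Fin n), e q i.succ = q.1.succAbove (q.2 i) := fun q i => by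
    simp [e, Fin.cycleRange_symm_succ]
  have hinj : Function.Injective e := by
    rintro ⟨p, τ⟩ ⟨p', τ'⟩ h
    obtain rfl : p = p' := by
      have := congrArg (fun s : Equiv.Perm (Fin (n + 1)) => s 0) h
      simpa only [he0] using this
    have : τ = τ' := Equiv.ext fun i => by
      have := congrArg (fun s : Equiv.Perm (Fin (n + 1)) => s i.succ) h
      simpa only [hes, Fin.succAbove_right_inj] using this
    rw [this]
  have hbij : Function.Bijective e := by
    refine (Fintype.bijective_iff_injective_and_card e).2 ⟨hinj, ?_⟩
    simp [Fintype.card_perm, Nat.factorial_succ]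
  unfold signedSum
  rw [← hbij.sum_comp, Fintype.sum_prod_type]
  refine Finset.sum_congr rfl fun p _ => ?_
  rw [Finset.mul_sum]
  refine Finset.sum_congr rfl fun τ _ => ?_
  have hx : x ∘ e (p, τ) = Fin.cons (x p) ((fun i => x (p.succAbove i)) ∘ τ) := by
    funext i
    rcases Fin.eq_zero_or_eq_succ i with rfl | ⟨j, rfl⟩
    · simp [he0]
    · simp [hes]
  rw [hx]
  simp [e, Fin.sign_cycleRange, mul_assoc]

/-- In a product over unordered pairs, the pairs that contain `p` are split off. -/
theorem prod_pairs_succAbove {K : Type*} [CommMonoid K] {n : ℕ} (f : Fin (n + 1) → Fin (n + 1) → K)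
    (hf : ∀ i j, f i j = f j i) (p : Fin (n + 1)) :
    ∏ i, ∏ j ∈ Finset.Ioi i, f i j = (∏ j, f p (p.succAbove j)) *
      ∏ i, ∏ j ∈ Finset.Ioi i, f (p.succAbove i) (p.succAbove j) := by
  have h : ∀ {m : ℕ} (g : Fin m → Fin m → K),
      ∏ i, ∏ j ∈ Finset.Ioi i, g i j = ∏ i, ∏ j, if i < j then g i j else 1 := fun g =>
    Finset.prod_congr rfl fun i _ => by
      rw [← Finset.prod_filter]; congr 1; ext; simp
  rw [h, h, Fin.prod_univ_succAbove _ p]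
  simp only [Fin.prod_univ_succAbove _ p, lt_irrefl, if_false, one_mul,
    Fin.succAbove_lt_succAbove_iff, Finset.prod_mul_distrib]
  rw [← mul_assoc, ← Finset.prod_mul_distrib]
  congr 1
  refine Finset.prod_congr rfl fun j _ => ?_
  rcases lt_or_gt_of_ne (Fin.succAbove_ne p j) with hlt | hlt
  · rw [if_neg hlt.asymm, if_pos hlt, one_mul, hf]
  · rw [if_pos hlt, if_neg hlt.asymm, mul_one]

/-! ### The determinant side -/

/-- The determinant of the identity, with powers of `x⁻¹` cleared and `M` in the place of `m + 1`:
for `j = 0, …, n - 1`, its entries are `A ^ j B ^ (n - 1 - j) - x ^ M C ^ j D ^ (n - 1 - j)` with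
`A = x (1 + x)`, `B = 1 + w x`, `C = 1 + x`, `D = x (x + w)`. -/
def reflectedDet {K : Type*} [CommRing K] (w : K) (M : ℕ) {n : ℕ} (x : Fin n → K) : K :=
  Matrix.det (Matrix.of fun i j : Fin n =>
    (x i * (1 + x i)) ^ (j : ℕ) * (1 + w * x i) ^ (n - (j + 1 : ℕ)) -
      x i ^ M * ((1 + x i) ^ (j : ℕ) * (x i * (x i + w)) ^ (n - (j + 1 : ℕ))))

/-- The identities behind this form are `A + B = C + D` and `A = x C` in the notation of
`reflectedDet`: after division of row `i` by the power `s_i ^ (n - 1)` of the common sum `s_i`, the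
entries depend on `y_i = C_i / s_i` and `x_i y_i = A_i / s_i` (and on `x_i ^ M`) alone. -/
theorem reflectedDet_eq {K : Type*} [Field K] (w : K) (M : ℕ) {n : ℕ} (x s y : Fin n → K)
    (hs : ∀ i, s i = 1 + (1 + w) * x i + x i ^ 2) (hs0 : ∀ i, s i ≠ 0)
    (hy : ∀ i, y i = (1 + x i) / s i) :
    reflectedDet w M x = (∏ i, s i ^ (n - 1)) *
      Matrix.det (Matrix.of fun i j : Fin n =>
        (x i * y i) ^ (j : ℕ) - x i ^ M * y i ^ (j : ℕ)) := by
  rw [← det_monomial_sub_eq_det_pow_sub, ← Matrix.det_mul_column]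
  unfold reflectedDet
  congr 1
  ext i j
  have hsi := hs0 i
  have e1 : x i * (1 + x i) = s i * (x i * y i) := by rw [hy]; field_simp
  have e2 : 1 + w * x i = s i * (1 - x i * y i) := by rw [mul_sub, ← e1, hs]; ring
  have e3 : 1 + x i = s i * y i := by rw [hy]; field_simp
  have e4 : x i * (x i + w) = s i * (1 - y i) := by rw [mul_sub, ← e3, hs]; ring
  have e5 : s i ^ (n - 1) = s i ^ (j : ℕ) * s i ^ (n - (j + 1 : ℕ)) := by
    rw [← pow_add]; congr 1; omega
  simp only [Matrix.of_apply]
  rw [e1, e2, e3, e4, e5]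
  simp only [mul_pow]
  ring

/-- For `M = 0`, the first column of the determinant in `reflectedDet_eq` vanishes. -/
theorem reflectedDet_zero {K : Type*} [Field K] (w : K) {n : ℕ} (x : Fin (n + 1) → K)
    (hs0 : ∀ i, 1 + (1 + w) * x i + x i ^ 2 ≠ 0) : reflectedDet w 0 x = 0 := by
  rw [reflectedDet_eq w 0 x _ _ (fun _ => rfl) hs0 (fun _ => rfl),
    Matrix.det_eq_zero_of_column_eq_zero 0 (fun i => by simp), mul_zero]

theorem reflectedDet_succ {K : Type*} [Field K] (w : K) (M : ℕ) {n : ℕ} (x : Fin (n + 1) → K)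
    (hx : ∀ i, x i ≠ 0) (hx1 : ∀ i, 1 + x i ≠ 0)
    (hs0 : ∀ i, 1 + (1 + w) * x i + x i ^ 2 ≠ 0) :
    reflectedDet w (M + 1) x = (∏ i, x i) * reflectedDet w M x +
      ∑ p : Fin (n + 1), (-1) ^ (p : ℕ) * ((1 - x p) *
        ∏ j, (x (p.succAbove j) * ((1 - x p * x (p.succAbove j)) *
          (1 + w * x p + x (p.succAbove j) + x p * x (p.succAbove j))))) *
        reflectedDet w M (fun j => x (p.succAbove j)) := by
  obtain ⟨s, hs⟩ : ∃ s : Fin (n + 1) → K, ∀ i, s i = 1 + (1 + w) * x i + x i ^ 2 :=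
    ⟨_, fun _ => rfl⟩
  have hs0' : ∀ i, s i ≠ 0 := fun i => hs i ▸ hs0 i
  obtain ⟨y, hy⟩ : ∃ y : Fin (n + 1) → K, ∀ i, y i = (1 + x i) / s i := ⟨_, fun _ => rfl⟩
  have hy0 : ∀ i, y i ≠ 0 := fun i => by rw [hy]; exact div_ne_zero (hx1 i) (hs0' i)
  rw [reflectedDet_eq w (M + 1) x s y hs hs0' hy, reflectedDet_eq w M x s y hs hs0' hy]
  simp only [pow_succ' _ M]
  rw [det_sub_smul_recursion x y (fun i => x i ^ M) hx hy0, mul_add, mul_left_comm,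
    Finset.mul_sum]
  congr 1
  refine Finset.sum_congr rfl fun p _ => ?_
  rw [reflectedDet_eq w M (fun j => x (p.succAbove j)) (fun j => s (p.succAbove j))
    (fun j => y (p.succAbove j)) (fun j => hs _) (fun j => hs0' _) (fun j => hy _)]
  have hkey : (∏ i, s i ^ n) * ∏ j, (x (p.succAbove j) * (y (p.succAbove j) - x p * y p)) =
      (∏ j, (x (p.succAbove j) * ((1 - x p * x (p.succAbove j)) *
          (1 + w * x p + x (p.succAbove j) + x p * x (p.succAbove j))))) *
        ∏ j : Fin n, s (p.succAbove j) ^ (n - 1) := by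
    have hc : s p ^ n = ∏ _j : Fin n, s p := by simp
    rw [Fin.prod_univ_succAbove _ p, hc, ← Finset.prod_mul_distrib, ← Finset.prod_mul_distrib,
      ← Finset.prod_mul_distrib]
    refine Finset.prod_congr rfl fun j _ => ?_
    have hsp := hs0' p
    have hsj := hs0' (p.succAbove j)
    have e : s p * s (p.succAbove j) * (y (p.succAbove j) - x p * y p) =
        (1 - x p * x (p.succAbove j)) *
          (1 + w * x p + x (p.succAbove j) + x p * x (p.succAbove j)) := by
      rw [hy, hy]
      field_simp
      rw [hs, hs]
      ring
    rw [← e, ← pow_sub_one_mul (n := n) (by have := j.2; omega)]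
    ring
  rw [Nat.add_sub_cancel]
  linear_combination ((-1) ^ (p : ℕ) * (1 - x p) * Matrix.det (Matrix.of fun k j : Fin n =>
    (x (p.succAbove k) * y (p.succAbove k)) ^ (j : ℕ) -
      x (p.succAbove k) ^ M * y (p.succAbove k) ^ (j : ℕ))) * hkey

/-! ### The antisymmetrizer side and the comparison -/

/-- The antisymmetrized sum of the identity, evaluated at a point `x`, with `M` in the place of
`m + 1`. -/
def littlewoodSum {K : Type*} [CommRing K] (w : K) (M : ℕ) {n : ℕ} (x : Fin n → K) : K :=
  signedSum (fun z => (∏ i, ∏ j ∈ Finset.Ioi i, (1 + w * z i + z j + z i * z j)) *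
    strictMonoSum M z) x

theorem littlewoodSum_zero {K : Type*} [CommRing K] (w : K) {n : ℕ} (x : Fin (n + 1) → K) :
    littlewoodSum w 0 x = 0 := by
  simp [littlewoodSum, signedSum, strictMonoSum]

theorem littlewoodSum_succ {K : Type*} [CommRing K] (w : K) (M : ℕ) {n : ℕ}
    (x : Fin (n + 1) → K) :
    littlewoodSum w (M + 1) x = (∏ i, x i) * littlewoodSum w M x +
      ∑ p : Fin (n + 1), (-1) ^ (p : ℕ) * (∏ j, (x (p.succAbove j) *
          (1 + w * x p + x (p.succAbove j) + x p * x (p.succAbove j)))) *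
        littlewoodSum w M (fun j => x (p.succAbove j)) := by
  let k : (Fin (n + 1) → K) → K := fun z =>
    ∏ i, ∏ j ∈ Finset.Ioi i, (1 + w * z i + z j + z i * z j)
  have h1 : littlewoodSum w (M + 1) x = (∏ i, x i) * littlewoodSum w M x +
      signedSum (fun z => k z * ((∏ i : Fin n, z i.succ) *
        strictMonoSum M (fun i => z i.succ))) x := by
    simp only [littlewoodSum, signedSum, Finset.mul_sum]
    rw [← Finset.sum_add_distrib]
    refine Finset.sum_congr rfl fun σ _ => ?_
    rw [strictMonoSum_succ, ← Equiv.prod_comp σ x]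
    simp only [k, Function.comp_apply]
    ring
  rw [h1, signedSum_succ]
  congr 1
  refine Finset.sum_congr rfl fun p _ => ?_
  rw [mul_assoc]
  congr 1
  simp only [littlewoodSum, signedSum, Finset.mul_sum]
  refine Finset.sum_congr rfl fun τ _ => ?_
  rw [← Equiv.prod_comp τ (fun j => x (p.succAbove j) *
    (1 + w * x p + x (p.succAbove j) + x p * x (p.succAbove j)))]
  simp only [k, Fin.prod_univ_succ, Fin.prod_Ioi_zero, Fin.prod_Ioi_succ, Fin.cons_zero,
    Fin.cons_succ, Finset.prod_mul_distrib, Function.comp_apply]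
  ring_nf
  rfl

/-- Both sides satisfy the same recursion in `M` and agree for `M = 0` and for `n = 0`. -/
theorem littlewoodSum_mul_eq_reflectedDet {K : Type*} [Field K] (w : K) (M : ℕ) {n : ℕ}
    (x : Fin n → K) (hx : ∀ i, x i ≠ 0) (hx1 : ∀ i, 1 + x i ≠ 0)
    (hs0 : ∀ i, 1 + (1 + w) * x i + x i ^ 2 ≠ 0) :
    littlewoodSum w M x *
      ((∏ i, (1 - x i)) * ∏ i, ∏ j ∈ Finset.Ioi i, (1 - x i * x j)) = reflectedDet w M x := by
  induction M generalizing n with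
  | zero =>
    cases n with
    | zero => simp [littlewoodSum, signedSum, strictMonoSum, reflectedDet]
    | succ n => rw [littlewoodSum_zero, reflectedDet_zero w x hs0, zero_mul]
  | succ M ih =>
    cases n with
    | zero => simp [littlewoodSum, signedSum, strictMonoSum, reflectedDet]
    | succ n =>
      rw [littlewoodSum_succ, reflectedDet_succ w M x hx hx1 hs0, ← ih x hx hx1 hs0, add_mul,
        mul_assoc, Finset.sum_mul]
      congr 1
      refine Finset.sum_congr rfl fun p _ => ?_
      rw [← ih (fun j => x (p.succAbove j)) (fun _ => hx _) (fun _ => hx1 _) (fun _ => hs0 _),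
        prod_pairs_succAbove (fun i j => 1 - x i * x j) (fun i j => by rw [mul_comm]) p,
        Fin.prod_univ_succAbove (fun i => 1 - x i) p]
      simp only [Finset.prod_mul_distrib]
      ring

/-! ### The identity for rational functions -/

theorem toRat_ne_zero_of_eval_zero {n : ℕ} {R : Type*} [CommRing R] [IsDomain R]
    (f : MvPolynomial (Fin n) R) (hf : MvPolynomial.eval 0 f ≠ 0) : toRat f ≠ 0 := by
  rw [Ne, FaithfulSMul.algebraMap_eq_zero_iff]
  rintro rfl
  simp at hf

theorem toRat_ASym_eq_littlewoodSum {R : Type*} [CommRing R] [IsDomain R] (n M : ℕ) (w : R) :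
    toRat (ASym
        ((∏ i : Fin n, ∏ j ∈ Finset.Ioi i,
            (1 + MvPolynomial.C w * MvPolynomial.X i + MvPolynomial.X j
              + MvPolynomial.X i * MvPolynomial.X j)) *
          ∑ k : Fin n → Fin M with (∀ i j : Fin n, i < j → k i < k j),
            ∏ i : Fin n, (MvPolynomial.X i : MvPolynomial (Fin n) R) ^ (k i : ℕ))) =
      littlewoodSum (ratC n w) M (ratX R) := by
  simp [ASym, littlewoodSum, signedSum, strictMonoSum, toRat, ratX, ratC]

theorem mainTheorem3 {R : Type*} [CommRing R] [IsDomain R] (n m : ℕ) (hn : 1 ≤ n) (w : R) :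
    (1 / ∏ i : Fin n, ∏ j ∈ Finset.Ioi i, (ratX R j - ratX R i)) *
      toRat (ASym
        ((∏ i : Fin n, ∏ j ∈ Finset.Ioi i,
            (1 + MvPolynomial.C w * MvPolynomial.X i + MvPolynomial.X j
              + MvPolynomial.X i * MvPolynomial.X j)) *
          ∑ k : Fin n → Fin (m + 1) with (∀ i j : Fin n, i < j → k i < k j),
            ∏ i : Fin n, (MvPolynomial.X i : MvPolynomial (Fin n) R) ^ (k i : ℕ))) =
    -- the column index `j : Fin n` starts at `0`, so `j + 1` is the one-based column index;
    -- since `j + 1 ≤ n`, the natural-number subtractions are exact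
    Matrix.det (Matrix.of fun i j : Fin n =>
        ratX R i ^ (j : ℕ) * (1 + ratX R i) ^ (j : ℕ)
            * (1 + ratC n w * ratX R i) ^ (n - ((j : ℕ) + 1))
          - ratX R i ^ (m + 2 * n - ((j : ℕ) + 1)) * (1 + (ratX R i)⁻¹) ^ (j : ℕ)
            * (1 + ratC n w * (ratX R i)⁻¹) ^ (n - ((j : ℕ) + 1))) /
      ((∏ i : Fin n, (1 - ratX R i)) *
        ∏ i : Fin n, ∏ j ∈ Finset.Ioi i,
          ((1 - ratX R i * ratX R j) * (ratX R j - ratX R i))) := by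
  have hX : ∀ i, ratX R (n := n) i ≠ 0 := fun i => by
    rw [Ne, FaithfulSMul.algebraMap_eq_zero_iff]
    exact MvPolynomial.X_ne_zero i
  have hX1 : ∀ i, 1 + ratX R (n := n) i ≠ 0 := fun i => by
    have h := toRat_ne_zero_of_eval_zero
      (1 + MvPolynomial.X i : MvPolynomial (Fin n) R) (by simp)
    rwa [toRat, map_add, map_one] at h
  have hX2 : ∀ i, 1 - ratX R (n := n) i ≠ 0 := fun i => by
    have h := toRat_ne_zero_of_eval_zero
      (1 - MvPolynomial.X i : MvPolynomial (Fin n) R) (by simp)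
    rwa [toRat, map_sub, map_one] at h
  have hX3 : ∀ i j, 1 - ratX R (n := n) i * ratX R j ≠ 0 := fun i j => by
    have h := toRat_ne_zero_of_eval_zero
      (1 - MvPolynomial.X i * MvPolynomial.X j : MvPolynomial (Fin n) R) (by simp)
    rwa [toRat, map_sub, map_mul, map_one] at h
  have hs : ∀ i, 1 + (1 + ratC n w) * ratX R i + ratX R i ^ 2 ≠ 0 := fun i => by
    have h := toRat_ne_zero_of_eval_zero
      (1 + (1 + MvPolynomial.C w) * MvPolynomial.X i + MvPolynomial.X i ^ 2 :
        MvPolynomial (Fin n) R) (by simp)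
    rwa [toRat, map_add, map_add, map_mul, map_add, map_pow, map_one] at h
  have hdet : Matrix.det (Matrix.of fun i j : Fin n =>
        ratX R i ^ (j : ℕ) * (1 + ratX R i) ^ (j : ℕ)
            * (1 + ratC n w * ratX R i) ^ (n - ((j : ℕ) + 1))
          - ratX R i ^ (m + 2 * n - ((j : ℕ) + 1)) * (1 + (ratX R i)⁻¹) ^ (j : ℕ)
            * (1 + ratC n w * (ratX R i)⁻¹) ^ (n - ((j : ℕ) + 1))) =
      reflectedDet (ratC n w) (m + 1) (ratX R) := by
    unfold reflectedDet
    congr 1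
    ext i j
    have hi := hX i
    have hexp : m + 2 * n - ((j : ℕ) + 1) =
        (m + 1) + (j : ℕ) + ((n - ((j : ℕ) + 1)) + (n - ((j : ℕ) + 1))) := by omega
    have e1 : 1 + ratX R i = ratX R i * (1 + (ratX R i)⁻¹) := by field_simp; ring
    have e2 : ratX R i * (ratX R i + ratC n w) =
        ratX R i * ratX R i * (1 + ratC n w * (ratX R i)⁻¹) := by field_simp
    simp only [Matrix.of_apply]
    rw [e2, hexp]
    congr 1
    · rw [mul_pow]
    · rw [e1]
      simp only [mul_pow, pow_add]
      ring
  rw [toRat_ASym_eq_littlewoodSum, hdet,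
    ← littlewoodSum_mul_eq_reflectedDet (ratC n w) (m + 1) (ratX R) hX hX1 hs]
  have hD : (∏ i, (1 - ratX R (n := n) i)) *
      ∏ i, ∏ j ∈ Finset.Ioi i, (1 - ratX R (n := n) i * ratX R j) ≠ 0 :=
    mul_ne_zero (Finset.prod_ne_zero_iff.2 fun i _ => hX2 i)
      (Finset.prod_ne_zero_iff.2 fun i _ => Finset.prod_ne_zero_iff.2 fun j _ => hX3 i j)
  simp only [Finset.prod_mul_distrib]
  rw [← mul_assoc (∏ i, (1 - ratX R i)), mul_comm (littlewoodSum _ _ _),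
    mul_div_mul_left _ _ hD, one_div, div_eq_inv_mul]
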